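/- Let $\mathbb K$ be $\mathbb R$ or $\mathbb C$; all Banach spaces are over $\mathbb K$, and operators are linear. A Banach space $Y$ has the alternate quotient lifting property (AQLP) if for every Banach space $X$, every closed subspace $J \subseteq X$ and every bounded operator $S : Y \to X/J$ there is a bounded operator $\hat S : Y \to X$ with $S = \pi \circ \hat S$, where $\pi : X \to X/J$ is the quotient map. A Banach space $W$ has the alternate lifting property (ALP) if for all Banach spaces $X$ and $Z$, every bounded operator $\psi$ from $X$ onto $W$ and every bounded operator $S : Z \to W$ there is a bounded operator $\hat S : Z \to X$ with $S = \psi \circ \hat S$. **Theorem.** A Banach space $Y$ has the AQLP if and only if $Y$ is isomorphic (linearly homeomorphic) to $\ell_1(\Gamma)$ for some index set $\Gamma$ (possibly finite or empty). Moreover, $Y$ has the AQLP if and only if it has the ALP; that is, the class of Banach spaces with the AQLP coincides with the class of Banach spaces with the ALP. -/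

import Mathlib

universe u

/-- The alternate quotient lifting property (AQLP) of a Banach space `Y` over `𝕜`: for every Banach
space `X`, every closed subspace `J` of `X` and every bounded operator `S : Y → X ⧸ J`, there is a
bounded operator `T : Y → X` with `S = π ∘ T`, where `π : X → X ⧸ J` is the quotient map. -/
def HasAQLP (𝕜 : Type) [RCLike 𝕜] (Y : Type u) [NormedAddCommGroup Y] [NormedSpace 𝕜 Y] : Prop :=
  ∀ (X : Type u) [NormedAddCommGroup X] [NormedSpace 𝕜 X] [CompleteSpace X]
    (J : Submodule 𝕜 X), IsClosed (J : Set X) →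
    ∀ S : Y →L[𝕜] X ⧸ J, ∃ T : Y →L[𝕜] X, S = J.mkQL.comp T

/-- The alternate lifting property (ALP) of a Banach space `W` over `𝕜`: for all Banach spaces `X`
and `Z`, every bounded operator `ψ` from `X` onto `W` and every bounded operator `S : Z → W`, there
is a bounded operator `T : Z → X` with `S = ψ ∘ T`. -/
def HasALP (𝕜 : Type) [RCLike 𝕜] (W : Type u) [NormedAddCommGroup W] [NormedSpace 𝕜 W] : Prop :=
  ∀ (X Z : Type u) [NormedAddCommGroup X] [NormedSpace 𝕜 X] [CompleteSpace X]
    [NormedAddCommGroup Z] [NormedSpace 𝕜 Z] [CompleteSpace Z]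
    (ψ : X →L[𝕜] W), Function.Surjective ψ →
    ∀ S : Z →L[𝕜] W, ∃ T : Z →L[𝕜] X, S = ψ.comp T

/-!
Both lifting properties of a Banach space `Y` are equivalent to a third one: every bounded operator
from a Banach space onto `Y` has a bounded linear right inverse (`SurjectionsSplit`). The passage to
AQLP is by a pullback, the passage from AQLP by the open mapping theorem, and ALP is immediate. The
spaces `ℓ₁(Γ)` have this property since bounded families of preimages of the unit vectors extend to
operators (`surjectionsSplit_of_equiv_ell1`).

Conversely, `Y` is a quotient of `ℓ₁(Y)`, so if surjections onto `Y` split then `Y` is complemented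
in `ℓ₁(Y)`. It remains to see that complemented subspaces of `ℓ₁` spaces are `ℓ₁` spaces, for index
sets of any cardinality. Take a maximal family `𝓕` of disjoint finite sets of indices, each carrying
most of the norm of some unit vector of `Y` (`Ell1.exists_maximal_disjoint_family`).

* The chosen unit vectors span a complemented copy of `ℓ₁(𝓕)` in `Y`
  (`Ell1.exists_complemented_of_disjoint_family`).
* By maximality, restriction to the union `U` of `𝓕` is bounded below on `Y`. If `U` is finite, then
  `Y` is finite-dimensional. If `U` is infinite, then `Y` has a dense subset of cardinality at most
  that of `U`, hence of `𝓕`, so `Y` is a quotient of `ℓ₁(𝓕)`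
  (`Ell1.exists_surjective_of_bounded_below`); as surjections onto `Y` split, `Y` is complemented
  in `ℓ₁(𝓕)`.

Thus, for infinite `U`, the spaces `Y` and `ℓ₁(𝓕)` are complemented in each other, and
Pełczyński's decomposition method (`Ell1.nonempty_equiv_of_complemented`) makes them isomorphic. The
`ℓ₁`-sum of copies of `Y` is avoided by an Eilenberg swindle inside `ℓ₁(ℕ × 𝓕)`
(`Ell1.nonempty_prod_equiv`).
-/

/-! ### The space `ℓ₁(Γ)` and its universal property -/

noncomputable section

/-- The Banach space `ℓ₁(Γ)` of absolutely summable families of scalars. -/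
abbrev Ell1 (𝕜 : Type*) [RCLike 𝕜] (Γ : Type*) : Type _ := lp (fun _ : Γ => 𝕜) 1

namespace Ell1

variable {𝕜 : Type*} [RCLike 𝕜] {Γ Λ : Type*}
variable {X : Type*} [NormedAddCommGroup X] [NormedSpace 𝕜 X]

lemma hasSum_norm (f : Ell1 𝕜 Γ) : HasSum (fun γ => ‖f γ‖) ‖f‖ := by
  simpa using lp.hasSum_norm (by simp) f

lemma sum_norm_le (f : Ell1 𝕜 Γ) (s : Finset Γ) : ∑ γ ∈ s, ‖f γ‖ ≤ ‖f‖ :=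
  sum_le_hasSum s (fun _ _ => norm_nonneg _) (hasSum_norm f)

variable (𝕜) in
open Classical in
/-- The unit vector of `ℓ₁(Γ)` at the index `γ`. -/
def e (γ : Γ) : Ell1 𝕜 Γ := lp.single 1 γ (1 : 𝕜)

@[simp]
lemma norm_e (γ : Γ) : ‖e 𝕜 γ‖ = 1 := by
  simp [e]

lemma e_apply_self (γ : Γ) : e 𝕜 γ γ = 1 := by
  simp [e]

lemma e_apply_ne {γ δ : Γ} (h : δ ≠ γ) : e 𝕜 γ δ = 0 := by
  simp [e, h]

lemma hasSum_smul_e (f : Ell1 𝕜 Γ) : HasSum (fun γ => f γ • e 𝕜 γ) f := by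
  classical
  refine (lp.hasSum_single (by simp) f).congr_fun fun γ => ?_
  rw [e, ← lp.single_smul, smul_eq_mul, mul_one]

/-- Operators on `ℓ₁(Γ)` are determined by their values on the unit vectors. -/
lemma clm_ext {S T : Ell1 𝕜 Γ →L[𝕜] X} (h : ∀ γ, S (e 𝕜 γ) = T (e 𝕜 γ)) : S = T := by
  ext f
  have hS := (hasSum_smul_e f).mapL S
  have hT := (hasSum_smul_e f).mapL T
  simp only [map_smul, h] at hS hT
  exact hS.unique hT

/-- An operator on `ℓ₁(Γ)` is bounded by its values on the unit vectors. -/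
lemma opNorm_le {T : Ell1 𝕜 Γ →L[𝕜] X} {C : ℝ} (hC : 0 ≤ C) (h : ∀ γ, ‖T (e 𝕜 γ)‖ ≤ C) :
    ‖T‖ ≤ C := by
  refine T.opNorm_le_bound hC fun f => ?_
  have hT := (hasSum_smul_e f).mapL T
  rw [← hT.tsum_eq]
  refine tsum_of_norm_bounded ((hasSum_norm f).mul_left C) fun γ => ?_
  rw [map_smul, norm_smul, mul_comm]
  gcongr
  exact h γ

variable [CompleteSpace X]

lemma summable_smul {u : Γ → X} {C : ℝ} (hu : ∀ γ, ‖u γ‖ ≤ C) (f : Ell1 𝕜 Γ) :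
    Summable fun γ => f γ • u γ := by
  refine .of_norm_bounded ((hasSum_norm f).summable.mul_right C) fun γ => ?_
  rw [norm_smul]
  gcongr
  exact hu γ

/-- The universal property of `ℓ₁(Γ)`: a bounded family `u` in a Banach space extends to the
operator `f ↦ ∑ f γ • u γ`. -/
def lift (u : Γ → X) (C : ℝ) (hu : ∀ γ, ‖u γ‖ ≤ C) : Ell1 𝕜 Γ →L[𝕜] X :=
  LinearMap.mkContinuous
    { toFun := fun f => ∑' γ, f γ • u γ
      map_add' := fun f g => by
        rw [← (summable_smul hu f).tsum_add (summable_smul hu g)]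
        simp [add_smul]
      map_smul' := fun c f => by
        rw [RingHom.id_apply, ← (summable_smul hu f).tsum_const_smul]
        simp [mul_smul] }
    C fun f => by
      refine tsum_of_norm_bounded ((hasSum_norm f).mul_left C) fun γ => ?_
      rw [norm_smul, mul_comm]
      gcongr
      exact hu γ

@[simp]
lemma lift_e (u : Γ → X) (C : ℝ) (hu : ∀ γ, ‖u γ‖ ≤ C) (γ : Γ) :
    lift (𝕜 := 𝕜) u C hu (e 𝕜 γ) = u γ := by
  refine (tsum_eq_single γ fun δ hδ => ?_).trans ?_
  · rw [e_apply_ne hδ, zero_smul]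
  · rw [e_apply_self, one_smul]

variable (𝕜) in
/-- The operator `ℓ₁(Γ) → ℓ₁(Λ)` that moves unit vectors along a map of index sets. -/
def map (σ : Γ → Λ) : Ell1 𝕜 Γ →L[𝕜] Ell1 𝕜 Λ :=
  lift (fun γ => e 𝕜 (σ γ)) 1 fun _ => (norm_e _).le

@[simp]
lemma map_e (σ : Γ → Λ) (γ : Γ) : map 𝕜 σ (e 𝕜 γ) = e 𝕜 (σ γ) := lift_e ..

variable (𝕜) in
/-- Bijective index sets have isomorphic `ℓ₁` spaces. -/
def congr (σ : Γ ≃ Λ) : Ell1 𝕜 Γ ≃L[𝕜] Ell1 𝕜 Λ :=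
  .equivOfInverse' (map 𝕜 σ) (map 𝕜 σ.symm) (clm_ext fun _ => by simp) (clm_ext fun _ => by simp)

variable (𝕜) in
open Classical in
/-- The operator `ℓ₁(Γ) → ℓ₁(A)` restricting a family to a subset of the index set. -/
def restrict (A : Set Γ) : Ell1 𝕜 Γ →L[𝕜] Ell1 𝕜 A :=
  lift (fun γ => if h : γ ∈ A then e 𝕜 ⟨γ, h⟩ else 0) 1 fun _ => by split_ifs <;> simp

lemma restrict_apply (A : Set Γ) (f : Ell1 𝕜 Γ) (a : A) : restrict 𝕜 A f a = f a := by
  classical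
  have : (lp.evalCLM 𝕜 (fun _ : A => 𝕜) 1 a).comp (restrict 𝕜 A) =
      lp.evalCLM 𝕜 (fun _ : Γ => 𝕜) 1 (a : Γ) := by
    refine clm_ext fun γ => ?_
    change restrict 𝕜 A (e 𝕜 γ) a = e 𝕜 γ a
    rw [restrict, lift_e]
    split_ifs with h
    · by_cases hγ : a = ⟨γ, h⟩
      · subst hγ; simp [e_apply_self]
      · rw [e_apply_ne hγ, e_apply_ne]
        rintro rfl; exact hγ rfl
    · rw [e_apply_ne]
      · rfl
      · rintro rfl; exact h a.2
  exact DFunLike.congr_fun this f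

end Ell1

end

/-! ### Lifting properties and splitting of surjections -/

/-- Every bounded operator from a Banach space onto `Y` has a bounded linear right inverse. -/
def SurjectionsSplit (𝕜 : Type) [RCLike 𝕜] (Y : Type u) [NormedAddCommGroup Y]
    [NormedSpace 𝕜 Y] : Prop :=
  ∀ (X : Type u) [NormedAddCommGroup X] [NormedSpace 𝕜 X] [CompleteSpace X] (ψ : X →L[𝕜] Y),
    Function.Surjective ψ → ∃ T : Y →L[𝕜] X, ∀ y, ψ (T y) = y

section Lifting

variable {𝕜 : Type} [RCLike 𝕜] {Y : Type u} [NormedAddCommGroup Y] [NormedSpace 𝕜 Y]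

/-- By the open mapping theorem, a surjection `ψ : X → Y` is, up to isomorphism, the quotient map
`X → X ⧸ ker ψ`. -/
lemma HasAQLP.surjectionsSplit [CompleteSpace Y] (h : HasAQLP 𝕜 Y) : SurjectionsSplit 𝕜 Y := by
  intro X _ _ _ ψ hψ
  have hcl : IsClosed (ψ.ker : Set X) := ψ.isClosed_ker
  have hbij : Function.Bijective (ψ.ker.liftQL ψ le_rfl) := by
    refine ⟨LinearMap.ker_eq_bot.1 (Submodule.ker_liftQ_eq_bot' _ _ rfl), fun y => ?_⟩
    obtain ⟨x, rfl⟩ := hψ y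
    exact ⟨ψ.ker.mkQ x, Submodule.liftQ_apply _ _ _⟩
  let φ : (X ⧸ ψ.ker) ≃L[𝕜] Y := .ofBijective (ψ.ker.liftQL ψ le_rfl)
    (LinearMap.ker_eq_bot.2 hbij.1) (LinearMap.range_eq_top.2 hbij.2)
  obtain ⟨T, hT⟩ := h X ψ.ker hcl φ.symm
  refine ⟨T, fun y => ?_⟩
  have h1 : φ.symm y = ψ.ker.mkQL (T y) := DFunLike.congr_fun hT y
  have h2 : φ (ψ.ker.mkQL (T y)) = ψ (T y) := Submodule.liftQ_apply _ _ (h := le_rfl) _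
  rw [← h2, ← h1, φ.apply_symm_apply]

lemma SurjectionsSplit.hasALP (h : SurjectionsSplit 𝕜 Y) : HasALP 𝕜 Y := by
  intro X Z _ _ _ _ _ _ ψ hψ S
  obtain ⟨T, hT⟩ := h X ψ hψ
  exact ⟨T.comp S, by ext z; exact (hT _).symm⟩

lemma HasALP.surjectionsSplit [CompleteSpace Y] (h : HasALP 𝕜 Y) : SurjectionsSplit 𝕜 Y := by
  intro X _ _ _ ψ hψ
  obtain ⟨T, hT⟩ := h X Y ψ hψ (.id 𝕜 Y)
  exact ⟨T, fun y => (DFunLike.congr_fun hT y).symm⟩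

/-- An operator `S : Y → X ⧸ J` is lifted by splitting the projection onto `Y` of the pullback
`{(x, y) | π x = S y}`. -/
lemma SurjectionsSplit.hasAQLP [CompleteSpace Y] (h : SurjectionsSplit 𝕜 Y) : HasAQLP 𝕜 Y := by
  intro X _ _ _ J hJ S
  have : IsClosed (J : Set X) := hJ
  let D : X × Y →L[𝕜] X ⧸ J := J.mkQL.comp (.fst 𝕜 X Y) - S.comp (.snd 𝕜 X Y)
  have : CompleteSpace D.ker := D.isClosed_ker.completeSpace_coe
  have hker : ∀ z : D.ker, J.mkQL z.1.1 = S z.1.2 := fun z => sub_eq_zero.1 z.2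
  obtain ⟨T, hT⟩ := h D.ker ((ContinuousLinearMap.snd 𝕜 X Y).comp D.ker.subtypeL) fun y => by
    obtain ⟨x, hx⟩ := J.mkQ_surjective (S y)
    exact ⟨⟨(x, y), sub_eq_zero.2 hx⟩, rfl⟩
  refine ⟨((ContinuousLinearMap.fst 𝕜 X Y).comp D.ker.subtypeL).comp T, ?_⟩
  ext y
  exact (((hker (T y)).trans (congrArg S (hT y)))).symm

/-- Surjections onto a space isomorphic to `ℓ₁(Γ)` split: the open mapping theorem provides a
bounded family of preimages of the unit vectors. -/
lemma surjectionsSplit_of_equiv_ell1 {Γ : Type*} (φ : Y ≃L[𝕜] Ell1 𝕜 Γ) :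
    SurjectionsSplit 𝕜 Y := by
  intro X _ _ _ ψ hψ
  obtain ⟨C, -, hC⟩ := ((φ : Y →L[𝕜] Ell1 𝕜 Γ).comp ψ).exists_preimage_norm_le
    (φ.surjective.comp hψ)
  choose g hg hgC using fun γ => hC (Ell1.e 𝕜 γ)
  let T : Ell1 𝕜 Γ →L[𝕜] X := Ell1.lift g C fun γ => by simpa using hgC γ
  have hT : ((φ : Y →L[𝕜] Ell1 𝕜 Γ).comp ψ).comp T = .id 𝕜 _ := Ell1.clm_ext fun γ => by
    simpa [T] using hg γ
  exact ⟨T.comp (φ : Y →L[𝕜] Ell1 𝕜 Γ), fun y => φ.injective (DFunLike.congr_fun hT (φ y))⟩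

end Lifting

/-! ### The Eilenberg swindle and Pełczyński decomposition -/

namespace Ell1

section Swindle

variable {𝕜 : Type*} [RCLike 𝕜] {Λ : Type*} {X : Type*} [NormedAddCommGroup X] [NormedSpace 𝕜 X]

/-- The Eilenberg swindle. If `X` is a complemented subspace of `E = ℓ₁(Λ)`, with projection
`q`, and `G = ℓ₁(ℕ × Λ)` is regarded as the `ℓ₁`-sum of countably many copies of `E`, then
`(x, (yₙ)) ↦ (x + (1 - q) y₀, q y₀ + (1 - q) y₁, q y₁ + (1 - q) y₂, …)` is an isomorphism of
`X × G` onto `G`. -/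
theorem nonempty_prod_equiv (i : X →L[𝕜] Ell1 𝕜 Λ) (p : Ell1 𝕜 Λ →L[𝕜] X)
    (hpi : ∀ x, p (i x) = x) : Nonempty ((X × Ell1 𝕜 (ℕ × Λ)) ≃L[𝕜] Ell1 𝕜 (ℕ × Λ)) := by
  let ι (n : ℕ) : Ell1 𝕜 Λ →L[𝕜] Ell1 𝕜 (ℕ × Λ) := map 𝕜 (Prod.mk n)
  let q : Ell1 𝕜 Λ →L[𝕜] Ell1 𝕜 Λ := i.comp p
  have hι (n : ℕ) : ‖ι n‖ ≤ 1 := opNorm_le zero_le_one fun γ => by simp [ι]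
  -- the right and left shifts, the zeroth coordinate, and the componentwise projection `q`
  let S : Ell1 𝕜 (ℕ × Λ) →L[𝕜] Ell1 𝕜 (ℕ × Λ) := map 𝕜 fun a => (a.1 + 1, a.2)
  let L : Ell1 𝕜 (ℕ × Λ) →L[𝕜] Ell1 𝕜 (ℕ × Λ) :=
    lift (fun a => if a.1 = 0 then 0 else e 𝕜 (a.1 - 1, a.2)) 1 fun _ => by split_ifs <;> simp
  let ε : Ell1 𝕜 (ℕ × Λ) →L[𝕜] Ell1 𝕜 Λ :=
    lift (fun a => if a.1 = 0 then e 𝕜 a.2 else 0) 1 fun _ => by split_ifs <;> simp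
  let Q : Ell1 𝕜 (ℕ × Λ) →L[𝕜] Ell1 𝕜 (ℕ × Λ) :=
    lift (fun a => ι a.1 (q (e 𝕜 a.2))) ‖q‖ fun a => by
      refine ((ι a.1).le_of_opNorm_le (hι _) _).trans ?_
      rw [one_mul]
      simpa using q.le_opNorm (e 𝕜 a.2)
  have hιe n lam : ι n (e 𝕜 lam) = e 𝕜 (n, lam) := map_e ..
  have hQe n lam : Q (e 𝕜 (n, lam)) = ι n (q (e 𝕜 lam)) := lift_e ..
  have hSι n y : S (ι n y) = ι (n + 1) y :=
    DFunLike.congr_fun (clm_ext (S := S.comp (ι n)) fun γ => by simp [S, ι]) y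
  have hLι n y : L (ι (n + 1) y) = ι n y :=
    DFunLike.congr_fun (clm_ext (S := L.comp (ι (n + 1))) fun γ => by simp [L, ι]) y
  have hLι0 y : L (ι 0 y) = 0 :=
    DFunLike.congr_fun (clm_ext (S := L.comp (ι 0)) (T := 0) fun γ => by simp [L, ι]) y
  have hει0 y : ε (ι 0 y) = y :=
    DFunLike.congr_fun (clm_ext (S := ε.comp (ι 0)) (T := .id 𝕜 _) fun γ => by simp [ε, ι]) y
  have hει n y : ε (ι (n + 1) y) = 0 :=
    DFunLike.congr_fun (clm_ext (S := ε.comp (ι (n + 1))) (T := 0) fun γ => by simp [ε, ι]) y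
  have hQι n y : Q (ι n y) = ι n (q y) :=
    DFunLike.congr_fun (clm_ext (S := Q.comp (ι n)) (T := (ι n).comp q) fun γ => by
      simp [hιe, hQe]) y
  have hqq y : q (q y) = q y := by simp [q, hpi]
  have ext_ι {Z : Type _} [NormedAddCommGroup Z] [NormedSpace 𝕜 Z]
      {A B : Ell1 𝕜 (ℕ × Λ) →L[𝕜] Z} (h : ∀ n y, A (ι n y) = B (ι n y)) (g) : A g = B g :=
    DFunLike.congr_fun (clm_ext fun a => by simpa [hιe] using h a.1 (e 𝕜 a.2)) g
  have hεS g : ε (S g) = 0 :=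
    ext_ι (A := ε.comp S) (B := 0) (fun n y => by simp [hSι, hει]) g
  have hεQ g : ε (Q g) = q (ε g) :=
    ext_ι (A := ε.comp Q) (B := q.comp ε) (fun n y => by
      cases n <;> simp [hQι, hει, hει0]) g
  have hpεQ g : p (ε (Q g)) = p (ε g) := by simp [hεQ, q, hpi]
  have hQQ g : Q (Q g) = Q g :=
    ext_ι (A := Q.comp Q) (fun n y => by simp [hQι, hqq]) g
  have hQS g : Q (S g) = S (Q g) :=
    ext_ι (A := Q.comp S) (B := S.comp Q) (fun n y => by simp [hQι, hSι]) g
  have hQL g : Q (L g) = L (Q g) :=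
    ext_ι (A := Q.comp L) (B := L.comp Q) (fun n y => by
      cases n <;> simp [hQι, hLι, hLι0]) g
  have hLS g : L (S g) = g :=
    ext_ι (A := L.comp S) (B := .id 𝕜 _) (fun n y => by simp [hLι, hSι]) g
  have hSL g : S (L (Q g)) = Q g - ι 0 (i (p (ε g))) :=
    ext_ι (A := (S.comp L).comp Q) (B := Q - (ι 0).comp (q.comp ε)) (fun n y => by
      cases n <;> simp [hQι, hLι, hSι, hLι0, hει, hει0]) g
  let Φ : X × Ell1 𝕜 (ℕ × Λ) →L[𝕜] Ell1 𝕜 (ℕ × Λ) :=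
    ((ι 0).comp i).coprod (.id 𝕜 _ - Q + S.comp Q)
  let Ψ : Ell1 𝕜 (ℕ × Λ) →L[𝕜] X × Ell1 𝕜 (ℕ × Λ) :=
    (p.comp ε).prod (.id 𝕜 _ - Q + L.comp Q)
  refine ⟨.equivOfInverse Φ Ψ ?_ ?_⟩
  · rintro ⟨x, g⟩
    have hQi : Q (ι 0 (i x)) = ι 0 (i x) := by simp [hQι, q, hpi]
    refine Prod.ext ?_ ?_
    · simp [Φ, Ψ, hει0, hpi, hεS, hpεQ]
    · simp [Φ, Ψ, hQi, hQQ, hQS, hLS, hLι0]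
  · intro g
    simp [Φ, Ψ, hQQ, hQL, hSL]

end Swindle

section Decomposition

variable {𝕜 : Type*} [RCLike 𝕜] {Λ : Type*} {X : Type*} [NormedAddCommGroup X] [NormedSpace 𝕜 X]

/-- Pełczyński's decomposition method: if `X` and `ℓ₁(Λ)`, with `Λ` infinite, are complemented in
each other, then they are isomorphic. -/
theorem nonempty_equiv_of_complemented [Infinite Λ]
    (i : X →L[𝕜] Ell1 𝕜 Λ) (p : Ell1 𝕜 Λ →L[𝕜] X) (hpi : ∀ x, p (i x) = x)
    (J : Ell1 𝕜 Λ →L[𝕜] X) (R : X →L[𝕜] Ell1 𝕜 Λ) (hRJ : ∀ y, R (J y) = y) :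
    Nonempty (X ≃L[𝕜] Ell1 𝕜 Λ) := by
  obtain ⟨σ⟩ : Nonempty (Λ ≃ ℕ × Λ) := by
    apply Cardinal.lift_mk_eq'.1
    simp
  let E := Ell1 𝕜 Λ
  let τ : E ≃L[𝕜] Ell1 𝕜 (ℕ × Λ) := congr 𝕜 σ
  obtain ⟨a⟩ := nonempty_prod_equiv i p hpi
  obtain ⟨b⟩ := nonempty_prod_equiv (.id 𝕜 E) (.id 𝕜 E) fun _ => rfl
  let absorb : (X × E) ≃L[𝕜] E := ((ContinuousLinearEquiv.refl 𝕜 X).prodCongr τ).trans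
    (a.trans τ.symm)
  let double : (E × E) ≃L[𝕜] E := ((ContinuousLinearEquiv.refl 𝕜 E).prodCongr τ).trans
    (b.trans τ.symm)
  let split : X ≃L[𝕜] E × R.ker := .equivOfRightInverse R J hRJ
  -- `X ≃ E × V ≃ (E × E) × V ≃ E × X ≃ E`, where `V = ker R`
  exact ⟨split.trans <| (double.symm.prodCongr (.refl 𝕜 R.ker)).trans <|
    (ContinuousLinearEquiv.prodAssoc 𝕜 E E R.ker).trans <|
    ((ContinuousLinearEquiv.refl 𝕜 E).prodCongr split.symm).trans <|
    (ContinuousLinearEquiv.prodComm 𝕜 E X).trans absorb⟩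

end Decomposition

end Ell1

/-! ### Quotients of `ℓ₁(Λ)` and density character -/

namespace Ell1

variable {𝕜 : Type*} [RCLike 𝕜]

section Generation

variable {Y : Type*} [NormedAddCommGroup Y] [NormedSpace 𝕜 Y]

/-- If the image of a group homomorphism `φ : M → Y` is dense, then a map from `Λ` onto `M` makes
`Y` a quotient of `ℓ₁(Λ)`: the elements of the image have preimages of the same norm, and this
bound passes to the closure. -/
lemma exists_surjective_of_denseRange [CompleteSpace Y] {M Λ : Type*} [AddGroup M] (φ : M →+ Y)
    (hφ : DenseRange φ) (σ : Λ → M) (hσ : Function.Surjective σ) :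
    ∃ T : Ell1 𝕜 Λ →L[𝕜] Y, Function.Surjective T := by
  let T : Ell1 𝕜 Λ →L[𝕜] Y := lift (fun l => ((‖φ (σ l)‖⁻¹ : ℝ) : 𝕜) • φ (σ l)) 1 fun l => by
    rw [norm_smul, RCLike.norm_ofReal, abs_of_nonneg (by positivity)]
    exact inv_mul_le_one
  let f : NormedAddGroupHom (Ell1 𝕜 Λ) Y :=
    AddMonoidHom.mkNormedAddGroupHom (T : Ell1 𝕜 Λ →ₗ[𝕜] Y).toAddMonoidHom ‖T‖ T.le_opNorm
  have hf : f.SurjectiveOnWith φ.range 1 := by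
    rintro _ ⟨m, rfl⟩
    obtain ⟨l, rfl⟩ := hσ m
    refine ⟨(‖φ (σ l)‖ : 𝕜) • e 𝕜 l, ?_, by simp [norm_smul]⟩
    change T _ = _
    rw [map_smul, lift_e, smul_smul, ← RCLike.ofReal_mul]
    rcases eq_or_ne (φ (σ l)) 0 with h | h
    · simp [h]
    · rw [mul_inv_cancel₀ (norm_ne_zero_iff.2 h), RCLike.ofReal_one, one_smul]
  have hf' := controlled_closure_of_complete one_pos one_pos hf
  refine ⟨T, fun y => ?_⟩
  obtain ⟨x, hx, -⟩ := hf' y (hφ y)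
  exact ⟨x, hx⟩

/-- The finite combinations of the unit vectors with coefficients in a countable dense set of
scalars generate a dense subgroup of `ℓ₁(A)`. -/
lemma denseRange_freeAddGroup_lift (A : Type*) :
    DenseRange (FreeAddGroup.lift fun a : A × ℕ =>
      TopologicalSpace.denseSeq 𝕜 a.2 • e 𝕜 a.1) := by
  set φ := FreeAddGroup.lift fun a : A × ℕ => TopologicalSpace.denseSeq 𝕜 a.2 • e 𝕜 a.1
  have hcl : IsClosed (φ.range.topologicalClosure : Set (Ell1 𝕜 A)) :=
    φ.range.isClosed_topologicalClosure
  have hsingle (a : A) (c : 𝕜) : c • e 𝕜 a ∈ φ.range.topologicalClosure := by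
    have hc : IsClosed {c : 𝕜 | c • e 𝕜 a ∈ φ.range.topologicalClosure} :=
      hcl.preimage (by fun_prop : Continuous fun c : 𝕜 => c • e 𝕜 a)
    refine hc.closure_subset_iff.2 ?_ (TopologicalSpace.denseRange_denseSeq 𝕜 c)
    rintro _ ⟨n, rfl⟩
    exact φ.range.le_topologicalClosure ⟨FreeAddGroup.of (a, n), FreeAddGroup.lift_apply_of ..⟩
  exact fun f => hcl.mem_of_tendsto (hasSum_smul_e f)
    (.of_forall fun s => sum_mem fun a _ => hsingle a _)

/-- A subspace inherits a dense family, indexed by `M × ℕ`, from a dense family indexed by `M`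
in the ambient space. -/
lemma exists_denseRange_of_bounded_below {E : Type*} [NormedAddCommGroup E] [NormedSpace 𝕜 E]
    (r : Y →L[𝕜] E) {C : ℝ} (hr : ∀ y, ‖y‖ ≤ C * ‖r y‖) {M : Type*} {φ : M → E}
    (hφ : DenseRange φ) : ∃ d : M × ℕ → Y, DenseRange d := by
  classical
  -- `d (m, n)` is a point whose image lies within `1 / (n + 1)` of `φ m`, if there is one
  refine ⟨fun a => if h : ∃ y, ‖r y - φ a.1‖ < 1 / ((a.2 : ℝ) + 1) then h.choose else 0,
    Metric.denseRange_iff.2 fun y δ hδ => ?_⟩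
  have hC : 0 < |C| + 1 := by positivity
  obtain ⟨n, hn⟩ := exists_nat_one_div_lt (show 0 < δ / (2 * (|C| + 1)) by positivity)
  obtain ⟨m, hm⟩ := hφ.exists_dist_lt (r y) (show 0 < 1 / ((n : ℝ) + 1) by positivity)
  rw [dist_eq_norm] at hm
  have h : ∃ y, ‖r y - φ m‖ < 1 / ((n : ℝ) + 1) := ⟨y, hm⟩
  refine ⟨(m, n), ?_⟩
  rw [dif_pos h, dist_eq_norm]
  have h1 : ‖r (y - h.choose)‖ ≤ 2 * (1 / ((n : ℝ) + 1)) := by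
    have : r (y - h.choose) = (r y - φ m) - (r h.choose - φ m) := by rw [map_sub]; abel
    rw [this]
    linarith [norm_sub_le (r y - φ m) (r h.choose - φ m), h.choose_spec]
  calc ‖y - h.choose‖ ≤ C * ‖r (y - h.choose)‖ := hr _
    _ ≤ (|C| + 1) * (2 * (1 / ((n : ℝ) + 1))) := by
      gcongr
      linarith [le_abs_self C]
    _ < (|C| + 1) * (2 * (δ / (2 * (|C| + 1)))) := by gcongr
    _ = δ := by field_simp

end Generation

/-- A Banach space that embeds into `ℓ₁(A)` with `A` infinite is a quotient of `ℓ₁(Λ)` as soon as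
`Λ` has at least the cardinality of `A`. -/
lemma exists_surjective_of_bounded_below {Y : Type*} [NormedAddCommGroup Y] [NormedSpace 𝕜 Y]
    [CompleteSpace Y] {A Λ : Type u} [Infinite A] (hA : Cardinal.mk A ≤ Cardinal.mk Λ)
    (r : Y →L[𝕜] Ell1 𝕜 A) {C : ℝ} (hr : ∀ y, ‖y‖ ≤ C * ‖r y‖) :
    ∃ T : Ell1 𝕜 Λ →L[𝕜] Y, Function.Surjective T := by
  obtain ⟨d, hd⟩ := exists_denseRange_of_bounded_below r hr (denseRange_freeAddGroup_lift A)
  let M := FreeAddGroup (FreeAddGroup (A × ℕ) × ℕ)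
  have hM : Cardinal.mk M ≤ Cardinal.mk Λ := by simpa [M] using hA
  obtain ⟨j⟩ := hM
  refine exists_surjective_of_denseRange (FreeAddGroup.lift d) (hd.mono ?_) (Function.invFun j)
    (Function.invFun_surjective j.injective)
  rintro _ ⟨a, rfl⟩
  exact ⟨FreeAddGroup.of a, FreeAddGroup.lift_apply_of ..⟩

end Ell1

/-! ### Complemented copies of `ℓ₁` in complemented subspaces of `ℓ₁(Γ)` -/

namespace Ell1

variable {𝕜 : Type*} [RCLike 𝕜] {Γ : Type*}

lemma norm_sub_sum_smul_e (f : Ell1 𝕜 Γ) (s : Finset Γ) :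
    ‖f - ∑ γ ∈ s, f γ • e 𝕜 γ‖ = ‖f‖ - ∑ γ ∈ s, ‖f γ‖ := by
  classical
  have h := lp.norm_compl_sum_single (by simp) f s
  simp only [ENNReal.toReal_one, Real.rpow_one] at h
  rw [← h]
  congr 2
  refine Finset.sum_congr rfl fun γ _ => ?_
  rw [e, ← lp.single_smul, smul_eq_mul, mul_one]

lemma sum_norm_le_norm_restrict (A : Set Γ) (f : Ell1 𝕜 Γ) {s : Finset Γ} (hs : ↑s ⊆ A) :
    ∑ γ ∈ s, ‖f γ‖ ≤ ‖restrict 𝕜 A f‖ := by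
  classical
  refine le_trans (le_of_eq ?_) (sum_norm_le (restrict 𝕜 A f) (s.subtype (· ∈ A)))
  simp_rw [restrict_apply]
  exact (Finset.sum_subtype_of_mem (fun γ => ‖f γ‖) hs).symm

variable {Y : Type*} [NormedAddCommGroup Y] [NormedSpace 𝕜 Y]

/-- A subspace `i : Y → ℓ₁(Γ)` contains a maximal family of unit vectors essentially concentrated
on pairwise disjoint finite sets. By maximality the norm on `Y` is controlled by the restriction to
the union of these finite sets. -/
theorem exists_maximal_disjoint_family (i : Y →L[𝕜] Ell1 𝕜 Γ) :
    ∃ 𝓕 : Set (Finset Γ), 𝓕.PairwiseDisjoint id ∧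
      (∀ A ∈ 𝓕, ∃ y, ‖i y‖ = 1 ∧ 3 / 4 < ∑ γ ∈ A, ‖i y γ‖) ∧
      ∀ y, ‖i y‖ ≤ 8 * ‖restrict 𝕜 (⋃ A ∈ 𝓕, (A : Set Γ)) (i y)‖ := by
  classical
  let good (A : Finset Γ) : Prop := ∃ y, ‖i y‖ = 1 ∧ 3 / 4 < ∑ γ ∈ A, ‖i y γ‖
  obtain ⟨𝓕, ⟨hgood, hdisj⟩, hmax⟩ := zorn_subset
    {𝓕 : Set (Finset Γ) | (∀ A ∈ 𝓕, good A) ∧ 𝓕.PairwiseDisjoint id} fun c hc hchain =>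
      ⟨⋃₀ c, ⟨fun A ⟨s, hs, hA⟩ => (hc hs).1 A hA,
        (hchain.pairwiseDisjoint_sUnion id).2 fun s hs => (hc hs).2⟩,
        fun s hs => Set.subset_sUnion_of_mem hs⟩
  refine ⟨𝓕, hdisj, hgood, fun y => ?_⟩
  set U : Set Γ := ⋃ A ∈ 𝓕, (A : Set Γ)
  by_contra! hlt
  have hpos : 0 < ‖i y‖ := lt_of_le_of_lt (by positivity) hlt
  -- finitely many coordinates carry most of `i y`; those outside `U` still carry enough to make
  -- a new member of the family
  obtain ⟨B, hB⟩ := ((hasSum_norm (i y)).eventually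
    (lt_mem_nhds (show 7 / 8 * ‖i y‖ < ‖i y‖ by linarith))).exists
  have hsplit := Finset.sum_filter_add_sum_filter_not B (· ∈ U) fun γ => ‖i y γ‖
  have hin : ∑ γ ∈ B with γ ∈ U, ‖i y γ‖ ≤ ‖restrict 𝕜 U (i y)‖ :=
    sum_norm_le_norm_restrict U (i y) fun γ hγ => (Finset.mem_filter.1 hγ).2
  set A := B.filter (· ∉ U)
  have hA : 3 / 4 * ‖i y‖ < ∑ γ ∈ A, ‖i y γ‖ := by linarith
  have hAgood : good A := by
    refine ⟨((‖i y‖⁻¹ : ℝ) : 𝕜) • y, ?_, ?_⟩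
    · rw [map_smul, norm_smul, RCLike.norm_ofReal, abs_of_pos (by positivity),
        inv_mul_cancel₀ hpos.ne']
    · have : ∀ γ, ‖i (((‖i y‖⁻¹ : ℝ) : 𝕜) • y) γ‖ = ‖i y‖⁻¹ * ‖i y γ‖ := fun γ => by
        rw [map_smul, lp.coeFn_smul, Pi.smul_apply, norm_smul, RCLike.norm_ofReal,
          abs_of_pos (by positivity)]
      simp_rw [this, ← Finset.mul_sum]
      rwa [lt_inv_mul_iff₀ hpos, mul_comm]
  have hAU : ∀ D ∈ 𝓕, Disjoint A D := fun D hD => Finset.disjoint_left.2 fun γ hγ hγD =>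
    (Finset.mem_filter.1 hγ).2 (Set.mem_biUnion hD hγD)
  have hmem : A ∈ 𝓕 := hmax (y := insert A 𝓕)
    ⟨fun D hD => hD.elim (fun h => h ▸ hAgood) (hgood D), hdisj.insert fun D hD _ => hAU D hD⟩
    (Set.subset_insert _ _) (Set.mem_insert _ _)
  have hempty : A = ∅ := Finset.disjoint_self_iff_empty A |>.1 (hAU A hmem)
  rw [hempty, Finset.sum_empty] at hA
  linarith

/-- Unit vectors of a complemented subspace `Y` of `ℓ₁(Γ)` that are essentially concentrated on
pairwise disjoint finite sets span a complemented copy of `ℓ₁` in `Y`. -/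
theorem exists_complemented_of_disjoint_family (i : Y →L[𝕜] Ell1 𝕜 Γ) [CompleteSpace Y]
    (p : Ell1 𝕜 Γ →L[𝕜] Y) (hpi : ∀ y, p (i y) = y) {𝓕 : Set (Finset Γ)}
    (hdisj : 𝓕.PairwiseDisjoint id)
    (hgood : ∀ A ∈ 𝓕, ∃ y, ‖i y‖ = 1 ∧ 3 / 4 < ∑ γ ∈ A, ‖i y γ‖) :
    ∃ (J : Ell1 𝕜 𝓕 →L[𝕜] Y) (R : Y →L[𝕜] Ell1 𝕜 𝓕), ∀ f, R (J f) = f := by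
  classical
  choose y hy1 hy using fun A : 𝓕 => hgood A A.2
  let J : Ell1 𝕜 𝓕 →L[𝕜] Y := lift y ‖p‖ fun A => by
    simpa [hpi, hy1] using p.le_opNorm (i (y A))
  -- `R₀` sends the unit vector at `γ ∈ A` to the unit vector at `A`, multiplied by the phase that
  -- turns the `γ`-coordinate of `i (y A)` into its absolute value
  let c (A : 𝓕) (γ : Γ) : 𝕜 := starRingEnd 𝕜 (i (y A) γ) / (‖i (y A) γ‖ : 𝕜)
  have hc (A : 𝓕) (γ : Γ) : ‖c A γ‖ ≤ 1 := by
    simp only [c, norm_div, RCLike.norm_conj, RCLike.norm_ofReal, abs_norm]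
    exact div_self_le_one _
  have hc' (A : 𝓕) (γ : Γ) : i (y A) γ * c A γ = (‖i (y A) γ‖ : 𝕜) := by
    rw [← mul_div_assoc, RCLike.mul_conj, sq, mul_self_div_self]
  let R₀ : Ell1 𝕜 Γ →L[𝕜] Ell1 𝕜 𝓕 :=
    lift (fun γ => if h : ∃ A : 𝓕, γ ∈ A.1 then c h.choose γ • e 𝕜 h.choose else 0) 1 fun γ => by
      split_ifs
      · simpa [norm_smul] using hc _ _
      · simp
  have hR₀e (A : 𝓕) (γ : Γ) (hγ : γ ∈ A.1) : R₀ (e 𝕜 γ) = c A γ • e 𝕜 A := by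
    have h : ∃ A : 𝓕, γ ∈ A.1 := ⟨A, hγ⟩
    have hA : h.choose = A := Subtype.ext <| by
      by_contra hne
      exact Finset.disjoint_left.1 (hdisj h.choose.2 A.2 hne) h.choose_spec hγ
    rw [lift_e, dif_pos h, hA]
  have hR₀ : ‖R₀‖ ≤ 1 := LinearMap.mkContinuous_norm_le _ zero_le_one _
  let T : Ell1 𝕜 𝓕 →L[𝕜] Ell1 𝕜 𝓕 := (R₀.comp i).comp J
  have hT : ‖1 - T‖ ≤ 1 / 2 := by
    refine opNorm_le (by norm_num) fun A => ?_
    set f := i (y A) with hf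
    set s := ∑ γ ∈ A.1, ‖f γ‖
    have hs : 3 / 4 < s := hy A
    have hs1 : s ≤ 1 := (sum_norm_le f A.1).trans_eq (hy1 A)
    have hmain : R₀ (∑ γ ∈ A.1, f γ • e 𝕜 γ) = (s : 𝕜) • e 𝕜 A := by
      rw [map_sum, RCLike.ofReal_sum, Finset.sum_smul]
      refine Finset.sum_congr rfl fun γ hγ => ?_
      rw [map_smul, hR₀e A γ hγ, smul_smul, hc']
    have hrest : ‖R₀ (f - ∑ γ ∈ A.1, f γ • e 𝕜 γ)‖ ≤ 1 - s := by
      refine (R₀.le_of_opNorm_le hR₀ _).trans_eq ?_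
      rw [one_mul, norm_sub_sum_smul_e, hy1]
    have hdecomp : (1 - T) (e 𝕜 A) =
        ((1 - s : ℝ) : 𝕜) • e 𝕜 A - R₀ (f - ∑ γ ∈ A.1, f γ • e 𝕜 γ) := by
      have : T (e 𝕜 A) = R₀ f := by simp [T, J, hf]
      rw [sub_apply, this, map_sub, hmain, RCLike.ofReal_sub,
        RCLike.ofReal_one, sub_smul, one_smul, one_apply_eq_self]
      abel
    rw [hdecomp]
    refine (norm_sub_le _ _).trans ?_
    rw [norm_smul, norm_e, mul_one, RCLike.norm_ofReal, abs_of_nonneg (by linarith)]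
    linarith
  -- `R₀ ∘ i` inverts `J` up to the operator `T`, which is invertible by the Neumann series
  let t : (Ell1 𝕜 𝓕 →L[𝕜] Ell1 𝕜 𝓕)ˣ := Units.oneSub (1 - T) (hT.trans_lt (by norm_num))
  have ht : (t : Ell1 𝕜 𝓕 →L[𝕜] Ell1 𝕜 𝓕) = T := sub_sub_cancel 1 T
  refine ⟨J, (↑t⁻¹ : Ell1 𝕜 𝓕 →L[𝕜] Ell1 𝕜 𝓕).comp (R₀.comp i), fun f => ?_⟩
  have h := t.inv_mul
  rw [ht] at h
  exact DFunLike.congr_fun h f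

end Ell1

/-! ### Spaces onto which surjections split -/

/-- A Banach space onto which all surjections split is isomorphic to some `ℓ₁(Γ)`: it is
complemented in `ℓ₁(Y)`, and complemented subspaces of `ℓ₁` spaces are `ℓ₁` spaces. -/
theorem SurjectionsSplit.exists_equiv_ell1 {𝕜 : Type} [RCLike 𝕜] {Y : Type u}
    [NormedAddCommGroup Y] [NormedSpace 𝕜 Y] [CompleteSpace Y] (h : SurjectionsSplit 𝕜 Y) :
    ∃ Γ : Type u, Nonempty (Y ≃L[𝕜] Ell1 𝕜 Γ) := by
  obtain ⟨p, hp⟩ := Ell1.exists_surjective_of_denseRange (𝕜 := 𝕜) (AddMonoidHom.id Y)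
    Function.surjective_id.denseRange id Function.surjective_id
  obtain ⟨i, hpi⟩ := h (Ell1 𝕜 Y) p hp
  obtain ⟨𝓕, hdisj, hgood, hU⟩ := Ell1.exists_maximal_disjoint_family i
  set U : Set Y := ⋃ A ∈ 𝓕, (A : Set Y)
  let r : Y →L[𝕜] Ell1 𝕜 U := (Ell1.restrict 𝕜 U).comp i
  have hr (y : Y) : ‖y‖ ≤ (‖p‖ * 8) * ‖r y‖ := by
    calc ‖y‖ = ‖p (i y)‖ := by rw [hpi]
      _ ≤ ‖p‖ * ‖i y‖ := p.le_opNorm _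
      _ ≤ ‖p‖ * (8 * ‖r y‖) := by gcongr; exact hU y
      _ = _ := by ring
  rcases finite_or_infinite U with hfin | hinf
  · have := Fintype.ofFinite U
    let π := ((lpPiLpₗᵢ (p := 1) (fun _ : U => 𝕜) 𝕜).toLinearEquiv : Ell1 𝕜 U ≃ₗ[𝕜] _)
    have : FiniteDimensional 𝕜 (Ell1 𝕜 U) := π.symm.finiteDimensional
    have hinj : Function.Injective r := (injective_iff_map_eq_zero r).2 fun y hy => by
      simpa [hy] using hr y
    have : FiniteDimensional 𝕜 Y := .of_injective (r : Y →ₗ[𝕜] Ell1 𝕜 U) hinj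
    let b := (Module.finBasis 𝕜 Y).reindex Equiv.ulift.{u}.symm
    exact ⟨ULift.{u} (Fin (Module.finrank 𝕜 Y)), ⟨(b.equivFun.trans
      ((WithLp.linearEquiv 1 𝕜 _).symm.trans
        (lpPiLpₗᵢ (p := 1) (fun _ => 𝕜) 𝕜).symm.toLinearEquiv)).toContinuousLinearEquiv⟩⟩
  · have h𝓕 : Infinite 𝓕 := by
      refine Set.infinite_coe_iff.2 fun hf => ?_
      exact Set.infinite_coe_iff.1 hinf (hf.biUnion fun A _ => A.finite_toSet)
    have hcard : Cardinal.mk U ≤ Cardinal.mk 𝓕 := by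
      calc Cardinal.mk U ≤ Cardinal.mk 𝓕 * ⨆ A : 𝓕, Cardinal.mk (A.1 : Set Y) :=
            Cardinal.mk_biUnion_le _ _
        _ ≤ Cardinal.mk 𝓕 * Cardinal.aleph0 := by
            gcongr
            exact ciSup_le' fun A => (Cardinal.lt_aleph0_of_finite _).le
        _ = Cardinal.mk 𝓕 := by simp
    obtain ⟨p', hp'⟩ := Ell1.exists_surjective_of_bounded_below hcard r hr
    obtain ⟨i', hpi'⟩ := h (Ell1 𝕜 𝓕) p' hp'
    obtain ⟨J, R, hRJ⟩ := Ell1.exists_complemented_of_disjoint_family i p hpi hdisj hgood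
    exact ⟨𝓕, Ell1.nonempty_equiv_of_complemented i' p' hpi' J R hRJ⟩

theorem mainTheorem2 {𝕜 : Type} [RCLike 𝕜] (Y : Type u) [NormedAddCommGroup Y]
    [NormedSpace 𝕜 Y] [CompleteSpace Y] :
    (HasAQLP 𝕜 Y ↔ ∃ Γ : Type u, Nonempty (Y ≃L[𝕜] lp (fun _ : Γ => 𝕜) 1)) ∧
      (HasAQLP 𝕜 Y ↔ HasALP 𝕜 Y) :=
  ⟨⟨fun h => h.surjectionsSplit.exists_equiv_ell1,
    fun ⟨_, ⟨φ⟩⟩ => (surjectionsSplit_of_equiv_ell1 φ).hasAQLP⟩,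
    fun h => h.surjectionsSplit.hasALP, fun h => h.surjectionsSplit.hasAQLP⟩
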